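/- Let $d\ge 1$ be an integer (e.g. $d\in\{1,2,3\}$), let $\Omega\subset\mathbb R^d$ be non-empty, open and bounded, let $0<\alpha<1$, $K\ge 0$ and $0=s_0<s_1<\dots<s_K<T<\infty$, and put $S=\{s_0,\dots,s_K\}$. Let $$Lv=-\sum_{i,j=1}^d a_{ij}\,\partial_i\partial_j v+\sum_{i=1}^d b_i\,\partial_i v+c\,v ,$$ where $a_{ij},b_i,c$ are continuous real functions on $\Omega$, the matrix $(a_{ij}(x))$ is symmetric positive definite for each $x\in\Omega$, and $\lambda:=\inf_{\Omega}L[1]=\inf_\Omega c>-\infty$ ($\lambda$ may have either sign). The Caputo derivative is $\partial_t^\alpha v(x,t)=\frac1{\Gamma(1-\alpha)}\int_0^t(t-s)^{-\alpha}\,\partial_s v(x,s)\,ds$. Let $H(t)=1$ for $t>0$ and $H(t)=0$ for $t\le 0$, and let $$f(x,t)=\sum_{k=0}^K H(t-s_k)\,f_k(x,t)$$ with $f_k$ continuous on $\Omega\times[s_k,T)$. Call a function $v:\overline\Omega\times[0,T)\to\mathbb R$ regular if it is continuous, $v(x,\cdot)$ is absolutely continuous on $[0,t]$ for all $x\in\Omega$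 and $t\in(0,T)$, for each $[a,b]\subset(0,T)\setminus S$ it is Lipschitz in time on $[a,b]$ uniformly in $x\in\Omega$, and $v(\cdot,t)\in C^2(\Omega)$ for each $t\in(0,T)\setminus S$. Let $u$ be a regular solution of $$(\partial_t^\alpha+L)u=f\ \text{ in }\Omega\times\bigl((0,T)\setminus S\bigr),\qquad u(\cdot,0)=u_0\ \text{ in }\Omega,\qquad u=0\ \text{ on }\partial\Omega\times(0,T),$$ and let $u_h$ (the numerical approximation) be a regular function with $u_h(\cdot,0)=u_0$ in $\Omega$ and $u_h=0$ on $\partial\Omega\times(0,T)$. Its residual is $Res:=f-(\partial_t^\alpha+L)u_h$. Let $w_0,\dots,w_K>0$, $W=\sum_{k=0}^K w_k$, $TOL>0$, and define the barrier $$\mathcal B(t)=\sum_{k=0}^K w_k\,H(t-s_k)\,\mathcal R(t-s_k),\qquad \mathcal R(t)=\lambda+\frac{t^{-\alpha}}{\Gamma(1-\alpha)}\ (t>0),\quad \mathcal R(t)=0\ (t\le0).$$ If $$\|Res(\cdot,t)\|_{L_\infty(\Omega)}\le TOL\cdot\mathcal B(t)\qquad\text{for all }t\in(0,T)\setminus S,$$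 then $$\|(u-u_h)(\cdot,t)\|_{L_\infty(\Omega)}\le TOL\sum_{k=0}^K w_k\,H(t-s_k)\le TOL\cdot W\qquad\text{for all }t\in(0,T).$$ -/

import Mathlib

open Set MeasureTheory
open scoped ENNReal

noncomputable section

namespace Subdiffusion

/-- The Heaviside step function, with the value `0` at `0`. -/
def heaviside (t : ℝ) : ℝ := if 0 < t then 1 else 0

/-- The Caputo derivative of order `α ∈ (0,1)` at the time `t > 0`:
`(∂_t^α g)(t) = Γ(1-α)⁻¹ ∫_0^t (t-s)^{-α} g'(s) ds`. -/
def caputo (α : ℝ) (g : ℝ → ℝ) (t : ℝ) : ℝ :=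
  (Real.Gamma (1 - α))⁻¹ * ∫ s in (0 : ℝ)..t, (t - s) ^ (-α) * deriv g s

/-- The partial derivative in the `i`-th coordinate of `ℝ^d`. -/
def partialDeriv {d : ℕ} (i : Fin d) (v : EuclideanSpace ℝ (Fin d) → ℝ)
    (x : EuclideanSpace ℝ (Fin d)) : ℝ :=
  fderiv ℝ v x (EuclideanSpace.single i 1)

/-- The second-order operator with variable coefficients
`L v = - ∑_{i,j} A_{ij} ∂_i ∂_j v + ∑_i b_i ∂_i v + c v`. -/
def ellipticOp {d : ℕ} (A : EuclideanSpace ℝ (Fin d) → Matrix (Fin d) (Fin d) ℝ)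
    (b : EuclideanSpace ℝ (Fin d) → Fin d → ℝ) (c : EuclideanSpace ℝ (Fin d) → ℝ)
    (v : EuclideanSpace ℝ (Fin d) → ℝ) (x : EuclideanSpace ℝ (Fin d)) : ℝ :=
  -(∑ i, ∑ j, A x i j * partialDeriv i (partialDeriv j v) x)
    + ∑ i, b x i * partialDeriv i v x + c x * v x

/-- `λ = inf L[1]`, the infimum over `Ω` of `L` applied to the constant function `1`. -/
def lowerConst {d : ℕ} (A : EuclideanSpace ℝ (Fin d) → Matrix (Fin d) (Fin d) ℝ)
    (b : EuclideanSpace ℝ (Fin d) → Fin d → ℝ) (c : EuclideanSpace ℝ (Fin d) → ℝ)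
    (Ω : Set (EuclideanSpace ℝ (Fin d))) : ℝ :=
  sInf (ellipticOp A b c (fun _ => 1) '' Ω)

/-- The right-hand side `∑_k H(t - s_k) f_k(x,t)`. -/
def jumpRhs {d K : ℕ} (s : Fin (K + 1) → ℝ)
    (f : Fin (K + 1) → EuclideanSpace ℝ (Fin d) → ℝ → ℝ)
    (x : EuclideanSpace ℝ (Fin d)) (t : ℝ) : ℝ :=
  ∑ k, heaviside (t - s k) * f k x t

/-- `(∂_t^α + L) v (x,t)`. -/
def subdiffOp {d : ℕ} (α : ℝ) (A : EuclideanSpace ℝ (Fin d) → Matrix (Fin d) (Fin d) ℝ)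
    (b : EuclideanSpace ℝ (Fin d) → Fin d → ℝ) (c : EuclideanSpace ℝ (Fin d) → ℝ)
    (v : EuclideanSpace ℝ (Fin d) → ℝ → ℝ) (x : EuclideanSpace ℝ (Fin d)) (t : ℝ) : ℝ :=
  caputo α (v x) t + ellipticOp A b c (fun y => v y t) x

/-- `R(t) = λ + t^{-α}/Γ(1-α)` for `t > 0`, and `R(t) = 0` for `t ≤ 0`. -/
def singleBarrier (α lam t : ℝ) : ℝ :=
  if 0 < t then lam + (Real.Gamma (1 - α))⁻¹ * t ^ (-α) else 0

/-- The generalized residual barrier `B(t) = ∑_k w_k H(t - s_k) R(t - s_k)`. -/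
def residualBarrier {K : ℕ} (α lam : ℝ) (w s : Fin (K + 1) → ℝ) (t : ℝ) : ℝ :=
  ∑ k, w k * heaviside (t - s k) * singleBarrier α lam (t - s k)

/-- The `L_∞(Ω)` norm (essential supremum for Lebesgue measure) as an extended real number. It is
`⊤` for functions that are not essentially bounded, and extended real values allow a comparison
with real numbers of either sign. -/
def linftyNorm {d : ℕ} (Ω : Set (EuclideanSpace ℝ (Fin d)))
    (g : EuclideanSpace ℝ (Fin d) → ℝ) : EReal :=
  ((eLpNorm g ∞ (volume.restrict Ω) : ℝ≥0∞) : EReal)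

/-- The regularity required of the exact and of the approximate solution, `S` being the set of
exceptional times: continuity on `closure Ω × [0,T)`, absolute continuity in time for each `x ∈ Ω`
(so that the integral defining the Caputo derivative makes sense), `W^{1,∞}(a,b; L_∞(Ω))` on each
`[a,b] ⊆ (0,T) \ S`, and `C²(Ω)` at each time of `(0,T) \ S`. -/
structure IsRegular {d : ℕ} (Ω : Set (EuclideanSpace ℝ (Fin d))) (T : ℝ) (S : Set ℝ)
    (v : EuclideanSpace ℝ (Fin d) → ℝ → ℝ) : Prop where
  continuousOn : ContinuousOn (fun p : EuclideanSpace ℝ (Fin d) × ℝ => v p.1 p.2)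
    (closure Ω ×ˢ Ico 0 T)
  absolutelyContinuous : ∀ x ∈ Ω, ∀ t ∈ Ioo 0 T, AbsolutelyContinuousOnInterval (v x) 0 t
  lipschitz : ∀ a b : ℝ, Icc a b ⊆ Ioo 0 T \ S → ∃ M : ℝ, ∀ x ∈ Ω,
    ∀ r ∈ Icc a b, ∀ t ∈ Icc a b, |v x r - v x t| ≤ M * |r - t|
  contDiffOn : ∀ t ∈ Ioo 0 T \ S, ContDiffOn ℝ 2 (fun x => v x t) Ω

end Subdiffusion

end

/-!
The difference `e = u - u_h` satisfies `(∂_t^α + L) e = Res`, vanishes initially and on the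
boundary, and has to stay below the step function `ψ(t) = TOL ∑ w_k H(t - s_k)` (the lower bound
follows by exchanging `u` and `u_h`). Formally `(∂_t^α + L) ψ ≥ TOL · B`, so this is a comparison
principle. Two points need care: `ψ` jumps, and the coefficient `c` may be negative.

For the jumps, integration by parts (`integral_kernel_mul_deriv_eq`) turns the Caputo derivative
into an integral of the increments `e(x,t) - e(x,s)` against a positive kernel. If `e(x,·)` lies
below a sum of steps up to the time `t` and meets it at `t`, the increments can be compared with
those of the steps, whose integrals are explicit (`le_caputo_of_le_sum_heaviside`). If moreover
`e(·,t)` has an interior maximum at `x`, then `L e ≥ c e` there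
(`mul_le_ellipticOp_of_isLocalMax`). Together they bound `(∂_t^α + L) e` from below by the barrier
of the steps (`sum_singleBarrier_le_subdiffOp_of_max`).

For the sign of `c`, the comparison advances in short time intervals. If the bound holds up to
`t₀` and fails just afterwards, a maximum point exceeds `ψ` by some `ε > 0`, and `e` touches there
the sum of `ψ` and the extra step `ε H(t - t₀)`. The barrier of the extra step is
`ε (λ + (t - t₀)^{-α} / Γ(1 - α))`, which is positive shortly after `t₀` whatever the sign of `λ`,
so `(∂_t^α + L) e` would exceed `TOL · B` (`exists_le_sum_heaviside_right`). Continuous induction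
then covers the whole time interval. The equation is never used at a jump time, because the
maximum is attained after `t₀` and before the next jump.

The hypothesis on the residual is an essential bound. It holds at every point because the residual
is continuous in space (`IsRegular.continuousOn_subdiffOp`, `abs_le_of_linftyNorm_le`).
-/

namespace Subdiffusion

open Filter
open scoped Topology

/-! ### The kernel of the Caputo derivative -/

theorem intervalIntegrable_sub_rpow {r : ℝ} (hr : -1 < r) (t a b : ℝ) :
    IntervalIntegrable (fun s : ℝ => (t - s) ^ r) volume a b := by
  have := (intervalIntegral.intervalIntegrable_rpow' (a := t - a) (b := t - b) hr).comp_sub_left t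
  simpa using this

theorem continuousOn_sub_rpow (r : ℝ) {t τ : ℝ} (hτ : τ < t) :
    ContinuousOn (fun s : ℝ => (t - s) ^ r) (Icc 0 τ) :=
  ContinuousOn.rpow_const (by fun_prop) fun s hs => Or.inl (by linarith [hs.2])

/-- The integrand of the Caputo derivative is integrable when `g` is absolutely continuous and is
Lipschitz near the final time: the derivative is integrable where the kernel is continuous, and
bounded where the kernel is singular. -/
theorem intervalIntegrable_kernel_mul_deriv {α t a M : ℝ} (hα : α < 1) {g : ℝ → ℝ} (ha : 0 ≤ a)
    (hat : a < t) (hg : AbsolutelyContinuousOnInterval g 0 t)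
    (hM : ∀ r ∈ Icc a t, ∀ s ∈ Icc a t, |g r - g s| ≤ M * |r - s|) :
    IntervalIntegrable (fun s => (t - s) ^ (-α) * deriv g s) volume 0 t := by
  have hd := hg.intervalIntegrable_deriv
  have h0t : uIcc 0 t = Icc 0 t := uIcc_of_le (by linarith)
  refine IntervalIntegrable.trans (b := a) ?_ ?_
  · refine IntervalIntegrable.continuousOn_mul (hd.mono_set ?_) ?_
    · rw [h0t, uIcc_of_le ha]; exact Icc_subset_Icc_right hat.le
    · rw [uIcc_of_le ha]; exact continuousOn_sub_rpow _ hat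
  · have hd' : IntervalIntegrable (deriv g) volume a t := hd.mono_set (by
      rw [h0t, uIcc_of_le hat.le]; exact Icc_subset_Icc_left ha)
    have hk := intervalIntegrable_sub_rpow (r := -α) (by linarith) t a t
    refine (hk.mul_const M).mono_fun' ?_ ?_
    · exact hk.aestronglyMeasurable_restrict_uIoc.mul hd'.aestronglyMeasurable_restrict_uIoc
    · rw [uIoc_of_le hat.le, EventuallyLE, ae_restrict_iff' measurableSet_Ioc]
      have hne : ∀ᵐ s : ℝ, s ≠ t := by simp [ae_iff, measure_singleton]
      filter_upwards [hne] with s hs hsI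
      have hs' : s ∈ Ioo a t := ⟨hsI.1, lt_of_le_of_ne hsI.2 hs⟩
      have : ‖deriv g s‖ ≤ M := by
        have hM0 : 0 ≤ M := by
          have h1 := hM a ⟨le_rfl, hat.le⟩ t ⟨hat.le, le_rfl⟩
          have h2 : 0 < |a - t| := abs_pos.2 (by linarith)
          by_contra! h3
          have := abs_nonneg (g a - g t)
          nlinarith
        refine norm_deriv_le_of_lip' hM0 ?_
        filter_upwards [Icc_mem_nhds hs'.1 hs'.2] with r hr
        exact hM r hr s ⟨hs'.1.le, hs'.2.le⟩
      rw [norm_mul, Real.norm_of_nonneg (Real.rpow_nonneg (by linarith [hs'.2]) _)]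
      exact mul_le_mul_of_nonneg_left this (Real.rpow_nonneg (by linarith [hs'.2]) _)

theorem abs_singular_kernel_mul_le {α t M s x : ℝ} (hα0 : 0 < α) (hst : s ≤ t)
    (hx : |x| ≤ M * (t - s)) :
    |(t - s) ^ (-α - 1) * x| ≤ M * (t - s) ^ (-α) := by
  rcases hst.eq_or_lt with rfl | h
  · have : x = 0 := by simpa using hx
    subst this
    -- Both sides vanish at `s = t`, where `0 ^ (-α) = 0`.
    simp [Real.zero_rpow (neg_ne_zero.2 hα0.ne')]
  · have hp : 0 < t - s := sub_pos.2 h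
    rw [abs_mul, abs_of_pos (Real.rpow_pos_of_pos hp _), Real.rpow_sub_one hp.ne']
    have := Real.rpow_pos_of_pos hp (-α)
    calc (t - s) ^ (-α) / (t - s) * |x| ≤ (t - s) ^ (-α) / (t - s) * (M * (t - s)) := by gcongr
      _ = _ := by field_simp

/-- A bound on `[0, t]` and a Lipschitz bound near `t` combine to a linear bound of `g t - g s` on
all of `[0, t]`, with a constant that depends on `g` only through the two bounds. -/
theorem exists_abs_sub_le_mul {t a M B : ℝ} (hat : a < t) :
    ∃ C : ℝ, 0 ≤ C ∧ ∀ g : ℝ → ℝ, (∀ s ∈ Icc 0 t, |g s| ≤ B) →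
      (∀ r ∈ Icc a t, ∀ s ∈ Icc a t, |g r - g s| ≤ M * |r - s|) →
      ∀ s ∈ Icc 0 t, |g t - g s| ≤ C * (t - s) := by
  refine ⟨max |M| (2 * |B| / (t - a)), le_max_of_le_left (abs_nonneg _), fun g hB hM s hs => ?_⟩
  have hts : 0 ≤ t - s := by linarith [hs.2]
  rcases le_total a s with h | h
  · have := hM t ⟨hat.le, le_rfl⟩ s ⟨h, hs.2⟩
    rw [abs_of_nonneg hts] at this
    exact this.trans (mul_le_mul_of_nonneg_right ((le_abs_self M).trans (le_max_left _ _)) hts)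
  · have h1 : |g t - g s| ≤ 2 * |B| := by
      have h2 := hB t ⟨hs.1.trans hs.2, le_rfl⟩
      have h3 := hB s hs
      have := abs_sub (g t) (g s)
      linarith [le_abs_self B]
    have hta : 0 < t - a := by linarith
    calc |g t - g s| ≤ 2 * |B| / (t - a) * (t - a) := by rw [div_mul_cancel₀ _ hta.ne']; exact h1
      _ ≤ 2 * |B| / (t - a) * (t - s) := by gcongr
      _ ≤ _ := by gcongr; exact le_max_right _ _

theorem intervalIntegrable_singular_kernel {α t M : ℝ} (hα0 : 0 < α) (hα : α < 1) (ht : 0 ≤ t)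
    {g : ℝ → ℝ}
    (hg : ContinuousOn g (Icc 0 t)) (hM : ∀ s ∈ Icc 0 t, |g t - g s| ≤ M * (t - s)) :
    IntervalIntegrable (fun s => (t - s) ^ (-α - 1) * (g t - g s)) volume 0 t := by
  refine ((intervalIntegrable_sub_rpow (r := -α) (by linarith) t 0 t).const_mul M).mono_fun' ?_ ?_
  · rw [uIoc_of_le ht]
    refine AEStronglyMeasurable.mul ?_ ?_
    · exact (Measurable.pow_const (by fun_prop) _).aestronglyMeasurable
    · exact ((continuousOn_const.sub hg).mono Ioc_subset_Icc_self).aestronglyMeasurable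
        measurableSet_Ioc
  · rw [uIoc_of_le ht, EventuallyLE, ae_restrict_iff' measurableSet_Ioc]
    exact Eventually.of_forall fun s hs =>
      abs_singular_kernel_mul_le hα0 hs.2 (hM s (Ioc_subset_Icc_self hs))

/-- Integration by parts in the Caputo derivative: the derivative of `g` is traded for the
increments `g t - g s`, weighted by a positive kernel. This form is monotone and continuous in
`g`. -/
theorem integral_kernel_mul_deriv_eq {α t M : ℝ} (hα0 : 0 < α) (hα : α < 1) (ht : 0 < t) {g : ℝ → ℝ}
    (hg : AbsolutelyContinuousOnInterval g 0 t)
    (hint : IntervalIntegrable (fun s => (t - s) ^ (-α) * deriv g s) volume 0 t)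
    (hM : ∀ s ∈ Icc 0 t, |g t - g s| ≤ M * (t - s)) :
    ∫ s in (0 : ℝ)..t, (t - s) ^ (-α) * deriv g s =
      t ^ (-α) * (g t - g 0) + α * ∫ s in (0 : ℝ)..t, (t - s) ^ (-α - 1) * (g t - g s) := by
  have hgc : ContinuousOn g (Icc 0 t) := by simpa [uIcc_of_le ht.le] using hg.continuousOn
  have hint2 := (intervalIntegrable_singular_kernel hα0 hα ht.le hgc hM).const_mul α
  rw [← intervalIntegral.integral_const_mul, ← sub_eq_iff_eq_add,
    ← intervalIntegral.integral_sub hint hint2]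
  set F : ℝ → ℝ := fun s => (t - s) ^ (-α) * deriv g s - α * ((t - s) ^ (-α - 1) * (g t - g s))
    with hF
  have hFint : IntervalIntegrable F volume 0 t := hint.sub hint2
  have key : ∀ τ ∈ Ioo 0 t, ∫ s in (0 : ℝ)..τ, F s =
      t ^ (-α) * (g t - g 0) - (t - τ) ^ (-α) * (g t - g τ) := by
    intro τ hτ
    have hd : ∀ s ∈ uIcc 0 τ, HasDerivAt (fun s : ℝ => (t - s) ^ (-α)) (α * (t - s) ^
        (-α - 1)) s := by
      intro s hs
      rw [uIcc_of_le hτ.1.le] at hs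
      have h1 : HasDerivAt (fun s : ℝ => t - s) (-1) s := by
        simpa using (hasDerivAt_id s).const_sub t
      convert h1.rpow_const (p := -α) (Or.inl (by linarith [hs.2, hτ.2])) using 1
      ring
    have hK : AbsolutelyContinuousOnInterval (fun s : ℝ => (t - s) ^ (-α)) 0 τ := by
      refine ContDiffOn.absolutelyContinuousOnInterval ?_
      intro s hs
      rw [uIcc_of_le hτ.1.le] at hs
      exact ContDiffWithinAt.rpow_const_of_ne (by fun_prop) (by linarith [hs.2, hτ.2])
    have hg' : AbsolutelyContinuousOnInterval (fun s => g s - g t) 0 τ := by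
      refine AbsolutelyContinuousOnInterval.fun_sub (hg.mono ?_) ?_
      · rw [uIcc_of_le hτ.1.le, uIcc_of_le ht.le]; exact Icc_subset_Icc_right hτ.2.le
      · exact (LipschitzWith.const (g t)).lipschitzOnWith.absolutelyContinuousOnInterval
    have := hK.integral_deriv_mul_eq_sub hg'
    rw [show t ^ (-α) * (g t - g 0) - (t - τ) ^ (-α) * (g t - g τ) = (t - τ) ^ (-α) * (g τ - g t)
      - (t - 0) ^ (-α) * (g 0 - g t) by rw [sub_zero]; ring, ← this]
    refine intervalIntegral.integral_congr fun s hs => ?_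
    simp only [hF, (hd s hs).deriv, deriv_sub_const]
    ring
  -- The kernel is singular at `t`, so the identity on `[0, τ]` is extended to `τ = t` by a limit.
  have hlim1 : Tendsto (fun τ => ∫ s in (0 : ℝ)..τ, F s) (𝓝[<] t) (𝓝 (∫ s in (0 : ℝ)..t, F s)) := by
    have := intervalIntegral.continuousOn_primitive_interval
      (intervalIntegrable_iff_integrableOn_Icc_of_le ht.le |>.1 hFint |> fun h => by
        rwa [← uIcc_of_le ht.le] at h)
    rw [uIcc_of_le ht.le] at this
    refine ((this t ⟨ht.le, le_rfl⟩).tendsto).mono_left ?_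
    rw [← nhdsWithin_Ioo_eq_nhdsLT ht]
    exact nhdsWithin_mono _ Ioo_subset_Icc_self
  have hIoo : ∀ᶠ τ in 𝓝[<] t, τ ∈ Ioo 0 t := Ioo_mem_nhdsLT ht
  have hlim2 : Tendsto (fun τ => t ^ (-α) * (g t - g 0) - (t - τ) ^ (-α) * (g t - g τ)) (𝓝[<] t)
      (𝓝 (t ^ (-α) * (g t - g 0) - 0)) := by
    refine tendsto_const_nhds.sub ?_
    have h0 : Tendsto (fun τ => M * (t - τ) ^ (1 - α)) (𝓝[<] t) (𝓝 0) := by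
      have : ContinuousAt (fun τ : ℝ => M * (t - τ) ^ (1 - α)) t :=
        continuousAt_const.mul (ContinuousAt.rpow_const (by fun_prop) (Or.inr (by linarith)))
      have h := this.tendsto
      simp only [sub_self, Real.zero_rpow (by linarith : (1 : ℝ) - α ≠ 0), mul_zero] at h
      exact h.mono_left nhdsWithin_le_nhds
    refine squeeze_zero_norm' ?_ h0
    filter_upwards [hIoo] with τ hτ
    have hp : 0 < t - τ := sub_pos.2 hτ.2
    rw [norm_mul, Real.norm_of_nonneg (Real.rpow_nonneg hp.le _),
      show (1 : ℝ) - α = -α + 1 by ring, Real.rpow_add_one hp.ne']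
    calc (t - τ) ^ (-α) * ‖g t - g τ‖ ≤ (t - τ) ^ (-α) * (M * (t - τ)) := by
          gcongr; exact hM τ ⟨hτ.1.le, hτ.2.le⟩
      _ = _ := by ring
  rw [sub_zero] at hlim2
  refine tendsto_nhds_unique hlim1 (hlim2.congr' ?_)
  filter_upwards [hIoo] with τ hτ
  rw [key τ hτ]

/-! ### Comparison with step functions -/

theorem heaviside_nonneg (t : ℝ) : 0 ≤ heaviside t := by
  unfold heaviside; split_ifs <;> norm_num

theorem heaviside_of_pos {t : ℝ} (h : 0 < t) : heaviside t = 1 := if_pos h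

theorem heaviside_of_nonpos {t : ℝ} (h : t ≤ 0) : heaviside t = 0 := if_neg h.not_gt

theorem heaviside_le_one (t : ℝ) : heaviside t ≤ 1 := by
  unfold heaviside; split_ifs <;> norm_num

theorem monotone_heaviside : Monotone heaviside := by
  intro a b h
  rcases lt_or_ge 0 a with h1 | h1
  · rw [heaviside_of_pos h1, heaviside_of_pos (h1.trans_le h)]
  · rw [heaviside_of_nonpos h1]; exact heaviside_nonneg b

/-- The contribution of a unit step at `σ` to the integral of increments. Since the step is
constant on `(σ, t]`, only `[0, σ]` counts, where the kernel is bounded. -/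
theorem integral_singular_kernel_heaviside {α t σ : ℝ} (hα0 : 0 < α) (ht : 0 < t)
    (hσ : 0 ≤ σ) :
    IntervalIntegrable (fun s => (t - s) ^ (-α - 1) * (heaviside (t - σ) - heaviside (s - σ)))
        volume 0 t ∧
      α * ∫ s in (0 : ℝ)..t, (t - s) ^ (-α - 1) * (heaviside (t - σ) - heaviside (s - σ)) =
        heaviside (t - σ) * ((t - σ) ^ (-α) - t ^ (-α)) := by
  rcases le_or_gt t σ with h | h
  · have h0 : EqOn (fun s => (t - s) ^ (-α - 1) * (heaviside (t - σ) - heaviside (s - σ)))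
        (fun _ => 0) (uIcc 0 t) := by
      intro s hs
      rw [uIcc_of_le ht.le] at hs
      simp [heaviside_of_nonpos (sub_nonpos.2 h), heaviside_of_nonpos (sub_nonpos.2 (hs.2.trans h))]
    refine ⟨(intervalIntegrable_const (c := (0 : ℝ))).congr
      fun s hs => (h0 (uIoc_subset_uIcc hs)).symm, ?_⟩
    rw [intervalIntegral.integral_congr h0, heaviside_of_nonpos (sub_nonpos.2 h)]
    simp
  · have h1 : EqOn (fun s => (t - s) ^ (-α - 1) * (heaviside (t - σ) - heaviside (s - σ)))
        (fun s => (t - s) ^ (-α - 1)) (uIcc 0 σ) := by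
      intro s hs
      rw [uIcc_of_le hσ] at hs
      simp [heaviside_of_pos (sub_pos.2 h), heaviside_of_nonpos (sub_nonpos.2 hs.2)]
    have h2 : EqOn (fun s => (t - s) ^ (-α - 1) * (heaviside (t - σ) - heaviside (s - σ)))
        (fun _ => 0) (uIoc σ t) := by
      intro s hs
      rw [uIoc_of_le h.le] at hs
      simp [heaviside_of_pos (sub_pos.2 h), heaviside_of_pos (sub_pos.2 hs.1)]
    have i1 : IntervalIntegrable (fun s => (t - s) ^ (-α - 1)) volume 0 σ := by
      refine ContinuousOn.intervalIntegrable ?_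
      rw [uIcc_of_le hσ]; exact continuousOn_sub_rpow _ h
    have i1' := i1.congr fun s hs => (h1 (uIoc_subset_uIcc hs)).symm
    have i2' := (intervalIntegrable_const (c := (0 : ℝ)) (μ := volume) (a := σ) (b := t)).congr
      fun s hs => (h2 hs).symm
    refine ⟨i1'.trans i2', ?_⟩
    rw [← intervalIntegral.integral_add_adjacent_intervals i1' i2',
      intervalIntegral.integral_congr h1, intervalIntegral.integral_congr_ae
        (Eventually.of_forall h2), intervalIntegral.integral_comp_sub_left (fun y => y ^
            (-α - 1)) t,
      integral_rpow (Or.inr ⟨by linarith, ?_⟩), heaviside_of_pos (sub_pos.2 h)]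
    · rw [sub_zero, show -α - 1 + 1 = -α by ring, intervalIntegral.integral_const]
      simp only [smul_zero, add_zero]
      field_simp
      ring
    · rw [sub_zero, uIcc_of_le (by linarith)]
      intro h0; linarith [h0.1]

/-- If `g` starts at `0`, stays below a sum of steps and meets it at the time `t`, then its Caputo
derivative at `t` is at least the sum of the singular functions `(t - σ i)^{-α} / Γ(1 - α)`, which
is the formal Caputo derivative of the sum of steps. The steps themselves are not absolutely
continuous, so `caputo` does not apply to them. -/
theorem le_caputo_of_le_sum_heaviside {ι : Type*} [Fintype ι] {α t M : ℝ} (hα0 : 0 < α) (hα : α < 1)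
    (ht : 0 < t) {g : ℝ → ℝ} (hg : AbsolutelyContinuousOnInterval g 0 t)
    (hint : IntervalIntegrable (fun s => (t - s) ^ (-α) * deriv g s) volume 0 t)
    (hM : ∀ s ∈ Icc 0 t, |g t - g s| ≤ M * (t - s)) (p σ : ι → ℝ) (hσ : ∀ i, 0 ≤ σ i)
    (hg0 : g 0 = 0) (hle : ∀ s ∈ Ioo 0 t, g s ≤ ∑ i, p i * heaviside (s - σ i))
    (heq : g t = ∑ i, p i * heaviside (t - σ i)) :
    ∑ i, p i * heaviside (t - σ i) * ((Real.Gamma (1 - α))⁻¹ * (t - σ i) ^ (-α)) ≤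
      caputo α g t := by
  have hgc : ContinuousOn g (Icc 0 t) := by simpa [uIcc_of_le ht.le] using hg.continuousOn
  have hΓ : 0 ≤ (Real.Gamma (1 - α))⁻¹ := inv_nonneg.2 (Real.Gamma_pos_of_pos (by linarith)).le
  have hK := fun i => integral_singular_kernel_heaviside hα0 ht (hσ i)
  have hmono : ∑ i, p i * ∫ s in (0 : ℝ)..t,
      (t - s) ^ (-α - 1) * (heaviside (t - σ i) - heaviside (s - σ i)) ≤
      ∫ s in (0 : ℝ)..t, (t - s) ^ (-α - 1) * (g t - g s) := by
    simp only [← intervalIntegral.integral_const_mul]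
    rw [← intervalIntegral.integral_finsetSum fun i _ => (hK i).1.const_mul (p i)]
    refine intervalIntegral.integral_mono_on_of_le_Ioo ht.le
      (by simpa only [Finset.sum_fn] using
        IntervalIntegrable.sum Finset.univ fun i _ => (hK i).1.const_mul (p i))
      (intervalIntegrable_singular_kernel hα0 hα ht.le hgc hM) fun s hs => ?_
    have : ∑ i, p i * ((t - s) ^ (-α - 1) * (heaviside (t - σ i) - heaviside (s - σ i))) =
        (t - s) ^ (-α - 1) * (g t - ∑ i, p i * heaviside (s - σ i)) := by
      rw [heq, ← Finset.sum_sub_distrib, Finset.mul_sum]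
      exact Finset.sum_congr rfl fun i _ => by ring
    rw [this]
    exact mul_le_mul_of_nonneg_left (by linarith [hle s hs])
      (Real.rpow_nonneg (by linarith [hs.2]) _)
  rw [caputo, integral_kernel_mul_deriv_eq hα0 hα ht hg hint hM, hg0, sub_zero]
  have h1 : ∑ i, p i * heaviside (t - σ i) * ((Real.Gamma (1 - α))⁻¹ * (t - σ i) ^ (-α)) =
      (Real.Gamma (1 - α))⁻¹ * (t ^ (-α) * g t + α * ∑ i, p i * ∫ s in (0 : ℝ)..t,
      (t - s) ^ (-α - 1) * (heaviside (t - σ i) - heaviside (s - σ i))) := by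
    rw [heq, Finset.mul_sum, Finset.mul_sum, ← Finset.sum_add_distrib, Finset.mul_sum]
    refine Finset.sum_congr rfl fun i _ => ?_
    have := (hK i).2
    rw [show ∀ x : ℝ, α * (p i * x) = p i * (α * x) by intro x; ring, this]
    ring
  rw [h1]
  gcongr

/-! ### The elliptic operator -/

section Elliptic

variable {d : ℕ}

theorem partialDeriv_partialDeriv_eq {Ω : Set (EuclideanSpace ℝ (Fin d))} (hΩ : IsOpen Ω)
    {v : EuclideanSpace ℝ (Fin d) → ℝ} (hv : ContDiffOn ℝ 2 v Ω)
    {x : EuclideanSpace ℝ (Fin d)} (hx : x ∈ Ω) (i j : Fin d) :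
    partialDeriv i (partialDeriv j v) x =
      fderiv ℝ (fderiv ℝ v) x (EuclideanSpace.single i 1) (EuclideanSpace.single j 1) := by
  have h1 : DifferentiableAt ℝ (fderiv ℝ v) x :=
    ((hv.fderiv_of_isOpen hΩ (m := 1) (by norm_num)).differentiableOn one_ne_zero).differentiableAt
      (hΩ.mem_nhds hx)
  unfold partialDeriv
  rw [fderiv_clm_apply h1 (differentiableAt_const _)]
  simp

/-- The second-order necessary condition at a local maximum. A positive second derivative along a
line would make the point a local minimum as well, hence the function constant along the line. -/
theorem fderiv_fderiv_apply_self_nonpos {F : Type*} [NormedAddCommGroup F] [NormedSpace ℝ F]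
    {v : F → ℝ} {x : F} (hv : ContDiffAt ℝ 2 v x) (hmax : IsLocalMax v x) (ξ : F) :
    fderiv ℝ (fderiv ℝ v) x ξ ξ ≤ 0 := by
  by_contra! hpos
  set l : ℝ → F := fun τ => x + τ • ξ with hl
  have hl0 : l 0 = x := by simp [hl]
  have hld : ∀ τ, HasDerivAt l ξ τ := fun τ => by
    simpa [hl] using ((hasDerivAt_id τ).smul_const ξ).const_add x
  have hlc : Tendsto l (𝓝 0) (𝓝 x) := by
    have := (hld 0).continuousAt.tendsto; rwa [hl0] at this
  have hdiff : ∀ᶠ y in 𝓝 x, DifferentiableAt ℝ v y := by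
    filter_upwards [hv.eventually (by simp)] with y hy
    exact hy.differentiableAt (by norm_num)
  have hd1 : deriv (v ∘ l) =ᶠ[𝓝 0] fun τ => fderiv ℝ v (l τ) ξ := by
    filter_upwards [hlc.eventually hdiff] with τ hτ
    exact (hτ.hasFDerivAt.comp_hasDerivAt τ (hld τ)).deriv
  have hd2 : deriv (deriv (v ∘ l)) 0 = fderiv ℝ (fderiv ℝ v) x ξ ξ := by
    rw [hd1.deriv_eq]
    have h1 : DifferentiableAt ℝ (fderiv ℝ v) (l 0) := by
      rw [hl0]
      exact (hv.fderiv_right (m := 1) (by norm_num)).differentiableAt one_ne_zero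
    have h2 := (h1.hasFDerivAt.comp_hasDerivAt 0 (hld 0)).clm_apply (hasDerivAt_const (0 : ℝ) ξ)
    simpa [hl0] using h2.deriv
  have hmax' : IsLocalMax (v ∘ l) 0 := by
    have := hlc.eventually hmax
    filter_upwards [this] with τ hτ
    simpa [hl0] using hτ
  have hmin : IsLocalMin (v ∘ l) 0 := by
    refine isLocalMin_of_deriv_deriv_pos (by rw [hd2]; exact hpos) hmax'.deriv_eq_zero ?_
    exact ContinuousAt.comp (by rw [hl0]; exact hv.continuousAt) (hld 0).continuousAt
  have hconst : v ∘ l =ᶠ[𝓝 0] fun _ => (v ∘ l) 0 := by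
    filter_upwards [hmax', hmin] with τ h1 h2 using le_antisymm h1 h2
  have h0 : deriv (v ∘ l) =ᶠ[𝓝 0] fun _ => 0 := by
    simpa using hconst.deriv
  rw [← hd2, h0.deriv_eq] at hpos
  simp at hpos

/-- Writing `M = Nᵀ N` turns the contraction of `M` with the form `B` into a sum of values of `B`
on the diagonal. -/
theorem sum_mul_apply_single_nonpos {M : Matrix (Fin d) (Fin d) ℝ} (hM : M.PosSemidef)
    (B : EuclideanSpace ℝ (Fin d) →L[ℝ] EuclideanSpace ℝ (Fin d) →L[ℝ] ℝ)
    (hB : ∀ ξ, B ξ ξ ≤ 0) :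
    ∑ i, ∑ j, M i j * B (EuclideanSpace.single i 1) (EuclideanSpace.single j 1) ≤ 0 := by
  obtain ⟨N, rfl⟩ : ∃ N : Matrix (Fin d) (Fin d) ℝ, M = N.conjTranspose * N := by
    open scoped MatrixOrder in
    exact CStarAlgebra.nonneg_iff_eq_star_mul_self.1 hM.nonneg
  have : ∑ i, ∑ j, (N.conjTranspose * N) i j *
      B (EuclideanSpace.single i 1) (EuclideanSpace.single j 1) =
      ∑ k, B (∑ i, N k i • EuclideanSpace.single i 1) (∑ j, N k j • EuclideanSpace.single j 1) := by
    simp only [map_sum, map_smul, _root_.sum_apply, _root_.smul_apply, Matrix.mul_apply,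
      Matrix.conjTranspose_apply, star_trivial, smul_eq_mul, Finset.sum_mul, Finset.mul_sum]
    refine ((Finset.sum_congr rfl fun i _ => Finset.sum_comm).trans Finset.sum_comm).trans ?_
    refine Finset.sum_congr rfl fun k _ => Finset.sum_comm.trans ?_
    exact Finset.sum_congr rfl fun j _ => Finset.sum_congr rfl fun i _ => by ring
  rw [this]
  exact Finset.sum_nonpos fun k _ => hB _


theorem ellipticOp_const_one (A : EuclideanSpace ℝ (Fin d) → Matrix (Fin d) (Fin d) ℝ)
    (b : EuclideanSpace ℝ (Fin d) → Fin d → ℝ) (c : EuclideanSpace ℝ (Fin d) → ℝ)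
    (x : EuclideanSpace ℝ (Fin d)) : ellipticOp A b c (fun _ => 1) x = c x := by
  have h : ∀ i : Fin d, partialDeriv i (fun _ : EuclideanSpace ℝ (Fin d) => (1 : ℝ)) = 0 := by
    intro i; ext y; simp [partialDeriv]
  have h' : ∀ i : Fin d, partialDeriv i (0 : EuclideanSpace ℝ (Fin d) → ℝ) = 0 := by
    intro i; ext y; simp [partialDeriv]
  simp [ellipticOp, h, h']

variable {A : EuclideanSpace ℝ (Fin d) → Matrix (Fin d) (Fin d) ℝ}
  {b : EuclideanSpace ℝ (Fin d) → Fin d → ℝ} {c : EuclideanSpace ℝ (Fin d) → ℝ}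
  {Ω : Set (EuclideanSpace ℝ (Fin d))} {v w : EuclideanSpace ℝ (Fin d) → ℝ}
  {x : EuclideanSpace ℝ (Fin d)}

/-- The elliptic maximum principle at a point: at a local maximum of `v`, the second-order part of
`L v` is nonnegative and the first-order part vanishes. -/
theorem mul_le_ellipticOp_of_isLocalMax (hΩ : IsOpen Ω) (hA : (A x).PosSemidef)
    (hv : ContDiffOn ℝ 2 v Ω) (hx : x ∈ Ω) (hmax : IsLocalMax v x) :
    c x * v x ≤ ellipticOp A b c v x := by
  have h1 : ∀ i, partialDeriv i v x = 0 := fun i => by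
    simp [partialDeriv, hmax.fderiv_eq_zero]
  have h2 := sum_mul_apply_single_nonpos hA (fderiv ℝ (fderiv ℝ v) x)
    (fderiv_fderiv_apply_self_nonpos (hv.contDiffAt (hΩ.mem_nhds hx)) hmax)
  simp only [ellipticOp, partialDeriv_partialDeriv_eq hΩ hv hx, h1, mul_zero,
    Finset.sum_const_zero]
  linarith

theorem ellipticOp_sub (hΩ : IsOpen Ω) (hv : ContDiffOn ℝ 2 v Ω) (hw : ContDiffOn ℝ 2 w Ω)
    (hx : x ∈ Ω) :
    ellipticOp A b c (fun y => v y - w y) x = ellipticOp A b c v x - ellipticOp A b c w x := by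
  have hd : ∀ {u : EuclideanSpace ℝ (Fin d) → ℝ}, ContDiffOn ℝ 2 u Ω → ∀ y ∈ Ω,
      DifferentiableAt ℝ u y := fun hu y hy =>
    (hu.differentiableOn two_ne_zero).differentiableAt (hΩ.mem_nhds hy)
  have hd2 : ∀ {u : EuclideanSpace ℝ (Fin d) → ℝ}, ContDiffOn ℝ 2 u Ω →
      DifferentiableAt ℝ (fderiv ℝ u) x := fun hu =>
    ((hu.fderiv_of_isOpen hΩ (m := 1) (by norm_num)).differentiableOn one_ne_zero).differentiableAt
      (hΩ.mem_nhds hx)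
  have h1 : fderiv ℝ (fun y => v y - w y) =ᶠ[𝓝 x] fun y => fderiv ℝ v y - fderiv ℝ w y := by
    filter_upwards [hΩ.mem_nhds hx] with y hy
    exact fderiv_fun_sub (hd hv y hy) (hd hw y hy)
  have h2 : fderiv ℝ (fderiv ℝ (fun y => v y - w y)) x =
      fderiv ℝ (fderiv ℝ v) x - fderiv ℝ (fderiv ℝ w) x := by
    rw [h1.fderiv_eq, fderiv_fun_sub (hd2 hv) (hd2 hw)]
  have h3 : ∀ i, partialDeriv i (fun y => v y - w y) x = partialDeriv i v x - partialDeriv i w x :=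
    fun i => by simp [partialDeriv, h1.eq_of_nhds]
  simp only [ellipticOp, partialDeriv_partialDeriv_eq hΩ hv hx,
    partialDeriv_partialDeriv_eq hΩ hw hx, partialDeriv_partialDeriv_eq hΩ (hv.sub hw) hx, h2, h3,
    _root_.sub_apply, mul_sub, Finset.sum_sub_distrib]
  ring

theorem continuousOn_ellipticOp (hΩ : IsOpen Ω) (hA : ContinuousOn A Ω) (hb : ContinuousOn b Ω)
    (hc : ContinuousOn c Ω) (hv : ContDiffOn ℝ 2 v Ω) : ContinuousOn (ellipticOp A b c v) Ω := by
  have h1 : ContinuousOn (fderiv ℝ v) Ω := hv.continuousOn_fderiv_of_isOpen hΩ (by norm_num)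
  have h2 : ContinuousOn (fderiv ℝ (fderiv ℝ v)) Ω :=
    (hv.fderiv_of_isOpen hΩ (m := 1) (by norm_num)).continuousOn_fderiv_of_isOpen hΩ le_rfl
  have h3 : ∀ i j, ContinuousOn (fun y => A y i j) Ω := fun i j =>
    (continuous_apply_apply i j).comp_continuousOn hA
  have h4 : ∀ i, ContinuousOn (fun y => b y i) Ω := fun i =>
      (continuous_apply i).comp_continuousOn hb
  have h5 : ∀ i j, ContinuousOn (partialDeriv i (partialDeriv j v)) Ω := fun i j =>
    ((h2.clm_apply continuousOn_const).clm_apply continuousOn_const).congr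
      fun y hy => partialDeriv_partialDeriv_eq hΩ hv hy i j
  refine ((continuousOn_finsetSum _ fun i _ => continuousOn_finsetSum _ fun j _ =>
    (h3 i j).mul (h5 i j)).neg.add (continuousOn_finsetSum _ fun i _ => (h4 i).mul ?_)).add
    (hc.mul hv.continuousOn)
  exact h1.clm_apply continuousOn_const

end Elliptic

/-! ### Regular functions -/

section Regular

theorem exists_Icc_subset_Ioo_diff {T t : ℝ} {S : Set ℝ} (hS : IsClosed S) (ht : t ∈ Ioo 0 T \ S) :
    ∃ a, 0 < a ∧ a < t ∧ Icc a t ⊆ Ioo 0 T \ S := by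
  have h : Ioo 0 T \ S ∈ 𝓝 t := (isOpen_Ioo.sdiff hS).mem_nhds ht
  obtain ⟨ε, hε, hεs⟩ := Metric.nhds_basis_closedBall.mem_iff.1 h
  rw [Real.closedBall_eq_Icc] at hεs
  have hsub : Icc (t - ε) t ⊆ Ioo 0 T \ S :=
    (Icc_subset_Icc_right (by linarith)).trans hεs
  exact ⟨t - ε, (hsub ⟨le_rfl, by linarith⟩).1.1, by linarith, hsub⟩

section
variable {α t : ℝ} {g h : ℝ → ℝ}

theorem caputo_sub (hg : AbsolutelyContinuousOnInterval g 0 t)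
    (hh : AbsolutelyContinuousOnInterval h 0 t)
    (hgi : IntervalIntegrable (fun s => (t - s) ^ (-α) * deriv g s) volume 0 t)
    (hhi : IntervalIntegrable (fun s => (t - s) ^ (-α) * deriv h s) volume 0 t) :
    caputo α (fun s => g s - h s) t = caputo α g t - caputo α h t := by
  rw [caputo, caputo, caputo, ← mul_sub, ← intervalIntegral.integral_sub hgi hhi]
  congr 1
  refine intervalIntegral.integral_congr_ae ?_
  filter_upwards [hg.ae_differentiableAt, hh.ae_differentiableAt] with s h1 h2 hs
  have hs' := uIoc_subset_uIcc hs
  rw [deriv_fun_sub (h1 hs') (h2 hs'), mul_sub]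

end

variable {d : ℕ} {Ω : Set (EuclideanSpace ℝ (Fin d))} {T α : ℝ} {S : Set ℝ}
  {v w : EuclideanSpace ℝ (Fin d) → ℝ → ℝ}

namespace IsRegular

theorem sub (hv : IsRegular Ω T S v) (hw : IsRegular Ω T S w) :
    IsRegular Ω T S (fun x t => v x t - w x t) where
  continuousOn := hv.continuousOn.sub hw.continuousOn
  absolutelyContinuous x hx t ht :=
    (hv.absolutelyContinuous x hx t ht).fun_sub (hw.absolutelyContinuous x hx t ht)
  lipschitz a b hab := by
    obtain ⟨M, hM⟩ := hv.lipschitz a b hab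
    obtain ⟨N, hN⟩ := hw.lipschitz a b hab
    refine ⟨M + N, fun x hx r hr t ht => ?_⟩
    calc |v x r - w x r - (v x t - w x t)| = |(v x r - v x t) - (w x r - w x t)| := by ring_nf
      _ ≤ |v x r - v x t| + |w x r - w x t| := abs_sub _ _
      _ ≤ (M + N) * |r - t| := by linarith [hM x hx r hr t ht, hN x hx r hr t ht]
  contDiffOn t ht := (hv.contDiffOn t ht).sub (hw.contDiffOn t ht)

theorem continuousOn_time (hv : IsRegular Ω T S v) {x : EuclideanSpace ℝ (Fin d)}
    (hx : x ∈ closure Ω) : ContinuousOn (v x) (Ico 0 T) :=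
  hv.continuousOn.comp (f := fun t => (x, t)) (by fun_prop) fun _ ht => ⟨hx, ht⟩

theorem continuousOn_space (hv : IsRegular Ω T S v) {t : ℝ} (ht : t ∈ Ico 0 T) :
    ContinuousOn (fun x => v x t) (closure Ω) :=
  hv.continuousOn.comp (f := fun x => (x, t)) (by fun_prop) fun _ hx => ⟨hx, ht⟩

theorem intervalIntegrable_kernel_mul_deriv (hv : IsRegular Ω T S v) (hS : IsClosed S) (hα : α < 1)
    {x : EuclideanSpace ℝ (Fin d)} (hx : x ∈ Ω) {t : ℝ} (ht : t ∈ Ioo 0 T \ S) :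
    IntervalIntegrable (fun s => (t - s) ^ (-α) * deriv (v x) s) volume 0 t := by
  obtain ⟨a, ha0, hat, hsub⟩ := exists_Icc_subset_Ioo_diff hS ht
  obtain ⟨M, hM⟩ := hv.lipschitz a t hsub
  exact Subdiffusion.intervalIntegrable_kernel_mul_deriv hα ha0.le hat
    (hv.absolutelyContinuous x hx t ht.1) (hM x hx)

/-- Linear control of the time increments up to a time outside the exceptional set, uniformly in
space. -/
theorem exists_abs_sub_le (hv : IsRegular Ω T S v) (hS : IsClosed S) (hΩ : Bornology.IsBounded Ω)
    {t : ℝ} (ht : t ∈ Ioo 0 T \ S) :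
    ∃ C, ∀ x ∈ Ω, ∀ s ∈ Icc 0 t, |v x t - v x s| ≤ C * (t - s) := by
  obtain ⟨a, ha0, hat, hsub⟩ := exists_Icc_subset_Ioo_diff hS ht
  obtain ⟨M, hM⟩ := hv.lipschitz a t hsub
  have hK : IsCompact (closure Ω ×ˢ Icc 0 t) := hΩ.isCompact_closure.prod isCompact_Icc
  obtain ⟨B, hB⟩ := hK.exists_bound_of_continuousOn (hv.continuousOn.mono
    (prod_mono_right (Icc_subset_Ico_right ht.1.2)))
  obtain ⟨C, -, hC⟩ := exists_abs_sub_le_mul (M := M) (B := B) hat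
  exact ⟨C, fun x hx => hC (v x) (fun s hs => hB (x, s) ⟨subset_closure hx, hs⟩) (hM x hx)⟩

theorem subdiffOp_sub (hv : IsRegular Ω T S v) (hw : IsRegular Ω T S w) (hS : IsClosed S)
    (hΩ : IsOpen Ω) (hα : α < 1) {A : EuclideanSpace ℝ (Fin d) → Matrix (Fin d) (Fin d) ℝ}
    {b : EuclideanSpace ℝ (Fin d) → Fin d → ℝ} {c : EuclideanSpace ℝ (Fin d) → ℝ}
    {x : EuclideanSpace ℝ (Fin d)} (hx : x ∈ Ω) {t : ℝ} (ht : t ∈ Ioo 0 T \ S) :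
    subdiffOp α A b c (fun y r => v y r - w y r) x t =
      subdiffOp α A b c v x t - subdiffOp α A b c w x t := by
  rw [subdiffOp, ellipticOp_sub hΩ (hv.contDiffOn t ht) (hw.contDiffOn t ht) hx,
    caputo_sub (hv.absolutelyContinuous x hx t ht.1) (hw.absolutelyContinuous x hx t ht.1)
      (hv.intervalIntegrable_kernel_mul_deriv hS hα hx ht)
      (hw.intervalIntegrable_kernel_mul_deriv hS hα hx ht), subdiffOp, subdiffOp]
  ring

/-- Continuity in space of the Caputo derivative, by dominated convergence in its
integrated-by-parts form. -/
theorem continuousOn_caputo (hv : IsRegular Ω T S v) (hS : IsClosed S)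
    (hΩ : IsOpen Ω) (hΩb : Bornology.IsBounded Ω) (hα : α ∈ Ioo 0 1) {t : ℝ}
    (ht : t ∈ Ioo 0 T \ S) : ContinuousOn (fun x => caputo α (v x) t) Ω := by
  obtain ⟨C, hC⟩ := hv.exists_abs_sub_le hS hΩb ht
  have heq : EqOn (fun x => caputo α (v x) t) (fun x => (Real.Gamma (1 - α))⁻¹ *
      (t ^ (-α) * (v x t - v x 0) + α * ∫ s in (0 : ℝ)..t, (t - s) ^ (-α - 1) * (v x t - v x s)))
      Ω := fun x hx => by
    simp only [caputo]
    rw [integral_kernel_mul_deriv_eq hα.1 hα.2 ht.1.1 (hv.absolutelyContinuous x hx t ht.1)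
      (hv.intervalIntegrable_kernel_mul_deriv hS hα.2 hx ht) (hC x hx)]
  have hcs : ∀ s ∈ Icc 0 t, ContinuousOn (fun x => v x s) Ω := fun s hs =>
    (hv.continuousOn_space ⟨hs.1, hs.2.trans_lt ht.1.2⟩).mono subset_closure
  have ht0 : (0 : ℝ) ≤ t := ht.1.1.le
  have hct := hcs t ⟨ht0, le_rfl⟩
  refine ContinuousOn.congr ?_ heq
  refine continuousOn_const.mul ((continuousOn_const.mul (hct.sub (hcs 0 ⟨le_rfl, ht0⟩))).add
    (continuousOn_const.mul fun x hx => ContinuousAt.continuousWithinAt ?_))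
  have hxn := hΩ.mem_nhds hx
  refine intervalIntegral.continuousAt_of_dominated_interval
    (bound := fun s => C * (t - s) ^ (-α)) ?_ ?_ ?_ ?_
  · filter_upwards [hxn] with y hy
    refine (intervalIntegrable_singular_kernel hα.1 hα.2 ht0 ?_
      (hC y hy)).aestronglyMeasurable_restrict_uIoc
    exact (hv.continuousOn_time (subset_closure hy)).mono (Icc_subset_Ico_right ht.1.2)
  · filter_upwards [hxn] with y hy
    refine Eventually.of_forall fun s hs => ?_
    rw [uIoc_of_le ht0] at hs
    exact abs_singular_kernel_mul_le hα.1 hs.2 (hC y hy s (Ioc_subset_Icc_self hs))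
  · exact (intervalIntegrable_sub_rpow (by linarith [hα.2]) t 0 t).const_mul C
  · refine Eventually.of_forall fun s hs => ?_
    rw [uIoc_of_le ht0] at hs
    exact continuousAt_const.mul ((hct.continuousAt hxn).sub
      ((hcs s (Ioc_subset_Icc_self hs)).continuousAt hxn))

theorem continuousOn_subdiffOp (hv : IsRegular Ω T S v) (hS : IsClosed S)
    (hΩ : IsOpen Ω) (hΩb : Bornology.IsBounded Ω) (hα : α ∈ Ioo 0 1)
    {A : EuclideanSpace ℝ (Fin d) → Matrix (Fin d) (Fin d) ℝ}
    {b : EuclideanSpace ℝ (Fin d) → Fin d → ℝ} {c : EuclideanSpace ℝ (Fin d) → ℝ}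
    (hA : ContinuousOn A Ω) (hb : ContinuousOn b Ω) (hc : ContinuousOn c Ω) {t : ℝ}
    (ht : t ∈ Ioo 0 T \ S) : ContinuousOn (fun x => subdiffOp α A b c v x t) Ω :=
  (hv.continuousOn_caputo hS hΩ hΩb hα ht).add
    (continuousOn_ellipticOp hΩ hA hb hc (hv.contDiffOn t ht))

end IsRegular

end Regular

/-! ### The essential supremum norm -/

section LinftyNorm

variable {d : ℕ} {Ω : Set (EuclideanSpace ℝ (Fin d))}

/-- For a continuous function on an open set the essential bound holds at every point. -/
theorem abs_le_of_linftyNorm_le (hΩ : IsOpen Ω) {g : EuclideanSpace ℝ (Fin d) → ℝ}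
    (hg : ContinuousOn g Ω) {C : ℝ} (h : linftyNorm Ω g ≤ (C : EReal)) :
    ∀ x ∈ Ω, |g x| ≤ C := by
  rw [linftyNorm, eLpNorm_exponent_top] at h
  have hae : ∀ᵐ x ∂volume.restrict Ω, |g x| ≤ C := by
    filter_upwards [ae_le_eLpNormEssSup (f := g) (μ := volume.restrict Ω)] with x hx
    have h1 : ((‖g x‖ₑ : ℝ≥0∞) : EReal) ≤ C := le_trans (by exact_mod_cast hx) h
    rw [← ofReal_norm, EReal.coe_ennreal_ofReal, max_eq_left (norm_nonneg _)] at h1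
    exact_mod_cast h1
  intro x hx
  by_contra! hlt
  have hmem : {y | ¬ |g y| ≤ C} ∩ Ω ∈ 𝓝 x := by
    refine inter_mem ?_ (hΩ.mem_nhds hx)
    filter_upwards [(hg.continuousAt (hΩ.mem_nhds hx)).abs.eventually (lt_mem_nhds hlt)] with y hy
    exact not_le.2 hy
  rw [ae_iff, Measure.restrict_apply' hΩ.measurableSet] at hae
  exact (Measure.measure_pos_of_mem_nhds volume hmem).ne' hae

theorem linftyNorm_le_of_abs_le (hΩ : MeasurableSet Ω) {g : EuclideanSpace ℝ (Fin d) → ℝ} {C : ℝ}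
    (hC : 0 ≤ C) (h : ∀ x ∈ Ω, |g x| ≤ C) : linftyNorm Ω g ≤ (C : EReal) := by
  have h1 : eLpNorm g ∞ (volume.restrict Ω) ≤ ENNReal.ofReal C := by
    rw [eLpNorm_exponent_top]
    exact eLpNormEssSup_le_of_ae_bound (ae_restrict_of_forall_mem hΩ h)
  calc linftyNorm Ω g ≤ ((ENNReal.ofReal C : ℝ≥0∞) : EReal) :=
        EReal.coe_ennreal_le_coe_ennreal_iff.2 h1
    _ = C := by rw [EReal.coe_ennreal_ofReal, max_eq_left hC]

end LinftyNorm

/-! ### The comparison principle -/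

section Comparison

variable {d : ℕ} {Ω : Set (EuclideanSpace ℝ (Fin d))} {T α : ℝ} {S : Set ℝ}
  {v w : EuclideanSpace ℝ (Fin d) → ℝ → ℝ}
variable {A : EuclideanSpace ℝ (Fin d) → Matrix (Fin d) (Fin d) ℝ}
    {b : EuclideanSpace ℝ (Fin d) → Fin d → ℝ} {c : EuclideanSpace ℝ (Fin d) → ℝ} {lam : ℝ}

/-- The comparison at a touching point: if `v x` stays below a sum of steps before the time `t`
and meets it at `t`, and `v · t` is maximal at `x`, then `(∂_t^α + L) v` at `(x, t)` is at least
the barrier of the steps. -/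
theorem sum_singleBarrier_le_subdiffOp_of_max {ι : Type*} [Fintype ι] (hv : IsRegular Ω T S v)
    (hS : IsClosed S) (hΩ : IsOpen Ω) (hΩb : Bornology.IsBounded Ω) (hα : α ∈ Ioo 0 1)
    {x : EuclideanSpace ℝ (Fin d)} (hx : x ∈ Ω) {t : ℝ} (ht : t ∈ Ioo 0 T \ S)
    (hA : (A x).PosSemidef) (hc : lam ≤ c x)
    (hmax : ∀ y ∈ Ω, v y t ≤ v x t) (p σ : ι → ℝ) (hσ : ∀ i, 0 ≤ σ i)
    (hv0 : v x 0 = 0) (hle : ∀ r ∈ Ioo 0 t, v x r ≤ ∑ i, p i * heaviside (r - σ i))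
    (heq : v x t = ∑ i, p i * heaviside (t - σ i)) (hpos : 0 ≤ v x t) :
    ∑ i, p i * heaviside (t - σ i) * singleBarrier α lam (t - σ i) ≤
      subdiffOp α A b c v x t := by
  obtain ⟨C, hC⟩ := hv.exists_abs_sub_le hS hΩb ht
  have h1 := le_caputo_of_le_sum_heaviside hα.1 hα.2 ht.1.1 (hv.absolutelyContinuous x hx t ht.1)
    (hv.intervalIntegrable_kernel_mul_deriv hS hα.2 hx ht) (hC x hx) p σ hσ hv0 hle heq
  have h2 : c x * v x t ≤ ellipticOp A b c (fun y => v y t) x :=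
    mul_le_ellipticOp_of_isLocalMax hΩ hA (hv.contDiffOn t ht) hx
      (mem_of_superset (hΩ.mem_nhds hx) hmax)
  have h3 : lam * v x t ≤ c x * v x t := mul_le_mul_of_nonneg_right hc hpos
  have h4 : ∑ i, p i * heaviside (t - σ i) * singleBarrier α lam (t - σ i) =
      lam * v x t +
      ∑ i, p i * heaviside (t - σ i) * ((Real.Gamma (1 - α))⁻¹ * (t - σ i) ^ (-α)) := by
    rw [heq, Finset.mul_sum, ← Finset.sum_add_distrib]
    refine Finset.sum_congr rfl fun i _ => ?_
    rcases lt_or_ge 0 (t - σ i) with h | h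
    · rw [singleBarrier, if_pos h]; ring
    · rw [heaviside_of_nonpos h]; ring
  rw [h4, subdiffOp]
  linarith

/-- Even when `lam` is negative, the barrier is positive for short times. -/
theorem exists_singleBarrier_pos (hα : α ∈ Ioo 0 1) (lam : ℝ) :
    ∃ δ > 0, ∀ t ∈ Ioo 0 δ, 0 < singleBarrier α lam t := by
  have h : Tendsto (fun t : ℝ => lam + (Real.Gamma (1 - α))⁻¹ * t ^ (-α)) (𝓝[>] 0) atTop :=
    tendsto_atTop_add_const_left _ _ (Tendsto.const_mul_atTop
      (inv_pos.2 (Real.Gamma_pos_of_pos (by linarith [hα.2])))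
      (tendsto_rpow_neg_nhdsGT_zero (by linarith [hα.1])))
  obtain ⟨δ, hδ, hsub⟩ := mem_nhdsGT_iff_exists_Ioo_subset.1 (h.eventually (eventually_gt_atTop 0))
  refine ⟨δ, hδ, fun t ht => ?_⟩
  rw [singleBarrier, if_pos ht.1]
  exact hsub ht

variable {K : ℕ} {s p : Fin (K + 1) → ℝ}

theorem monotone_sum_heaviside (hp : ∀ k, 0 ≤ p k) :
    Monotone fun t => ∑ k, p k * heaviside (t - s k) := fun a b h =>
  Finset.sum_le_sum fun k _ =>
    mul_le_mul_of_nonneg_left (monotone_heaviside (by linarith)) (hp k)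

/-- The bound by the sum of steps persists for a short time. Otherwise `v` exceeds the sum, which
is constant just after `t₀`, by some `ε > 0` at a maximum point over `[t₀, t₁]`. Adding a step of
height `ε` at `t₀` gives a sum of steps that `v` touches there, and for times close to `t₀` the
added step has a positive barrier, which contradicts the bound on `(∂_t^α + L) v`. -/
theorem exists_le_sum_heaviside_right (hΩ : IsOpen Ω) (hΩb : Bornology.IsBounded Ω)
    (hα : α ∈ Ioo 0 1) (hA : ∀ x ∈ Ω, (A x).PosSemidef) (hc : ∀ x ∈ Ω, lam ≤ c x)
    (hs : ∀ k, 0 ≤ s k) (hs0 : s 0 = 0) (hp : ∀ k, 0 < p k)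
    (hv : IsRegular Ω T (range s) v) (hinit : ∀ x ∈ closure Ω, v x 0 = 0)
    (hbdry : ∀ x ∈ frontier Ω, ∀ t ∈ Ioo 0 T, v x t = 0)
    (hop : ∀ x ∈ Ω, ∀ t ∈ Ioo 0 T \ range s,
      subdiffOp α A b c v x t ≤ residualBarrier α lam p s t)
    {t₀ : ℝ} (ht₀ : t₀ ∈ Ico 0 T)
    (hle : ∀ t ∈ Ioc 0 t₀, ∀ x ∈ closure Ω, v x t ≤ ∑ k, p k * heaviside (t - s k)) :
    ∃ δ > 0, ∀ t ∈ Ioo t₀ (t₀ + δ), ∀ x ∈ closure Ω, v x t ≤ ∑ k, p k * heaviside (t - s k) := by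
  obtain ⟨δ₁, hδ₁, hR⟩ := exists_singleBarrier_pos hα lam
  obtain ⟨u, hu, hSu⟩ : ∃ u > t₀, Ioo t₀ u ⊆ (range s)ᶜ := by
    have h : (range s \ {t₀})ᶜ ∈ 𝓝 t₀ :=
      ((finite_range s).subset sdiff_subset).isClosed.isOpen_compl.mem_nhds (by simp)
    obtain ⟨u, hu, hsub⟩ := mem_nhdsGT_iff_exists_Ioo_subset.1 (mem_nhdsWithin_of_mem_nhds h)
    refine ⟨u, hu, fun t ht hts => hsub ht ⟨hts, ht.1.ne'⟩⟩
  refine ⟨min δ₁ (min (u - t₀) (T - t₀)), lt_min hδ₁ (lt_min (by linarith) (by linarith [ht₀.2])),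
    fun t₁ ht₁ x₁ hx₁ => ?_⟩
  have hb1 : t₁ < t₀ + δ₁ := ht₁.2.trans_le (by gcongr; exact min_le_left _ _)
  have hb2 : t₁ < u := by
    have := (min_le_right δ₁ _).trans (min_le_left (u - t₀) (T - t₀)); linarith [ht₁.2]
  have hb3 : t₁ < T := by
    have := (min_le_right δ₁ _).trans (min_le_right (u - t₀) (T - t₀)); linarith [ht₁.2]
  set ψ : ℝ → ℝ := fun t => ∑ k, p k * heaviside (t - s k) with hψ
  have hψm : Monotone ψ := monotone_sum_heaviside fun k => (hp k).le
  have hψpos : ∀ t > 0, 0 < ψ t := fun t ht => by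
    refine Finset.sum_pos' (fun k _ => mul_nonneg (hp k).le (heaviside_nonneg _))
      ⟨0, Finset.mem_univ _, ?_⟩
    rw [hs0, sub_zero, heaviside_of_pos ht, mul_one]; exact hp 0
  have hψc : ∀ t ∈ Ioo t₀ u, ∀ t' ∈ Ioo t₀ u, ψ t ≤ ψ t' := fun t ht t' ht' => by
    refine Finset.sum_le_sum fun k _ => mul_le_mul_of_nonneg_left ?_ (hp k).le
    rcases le_or_gt (s k) t₀ with h | h
    · rw [heaviside_of_pos (by linarith [ht.1]), heaviside_of_pos (by linarith [ht'.1])]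
    · have : u ≤ s k := by
        by_contra! h'
        exact hSu ⟨h, h'⟩ ⟨k, rfl⟩
      rw [heaviside_of_nonpos (by linarith [ht.2])]
      exact heaviside_nonneg _
  have ht₁0 : 0 < t₁ := ht₀.1.trans_lt ht₁.1
  by_contra! hlt
  change ψ t₁ < v x₁ t₁ at hlt
  -- The maximum over `[t₀, t₁]` exceeds the sum of steps: it is attained after `t₀`, inside `Ω`.
  obtain ⟨⟨x, t⟩, ⟨hx, ht⟩, hmax⟩ :=
    (hΩb.isCompact_closure.prod (isCompact_Icc (a := t₀) (b := t₁))).exists_isMaxOn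
      ⟨(x₁, t₁), hx₁, ht₁.1.le, le_rfl⟩ (hv.continuousOn.mono
        (prod_mono_right fun r hr => ⟨ht₀.1.trans hr.1, hr.2.trans_lt hb3⟩))
  have hmax' : ∀ y ∈ closure Ω, ∀ r ∈ Icc t₀ t₁, v y r ≤ v x t := fun y hy r hr =>
    hmax (show (y, r) ∈ closure Ω ×ˢ Icc t₀ t₁ from ⟨hy, hr⟩)
  have hM : ψ t₁ < v x t := hlt.trans_le (hmax' x₁ hx₁ t₁ ⟨ht₁.1.le, le_rfl⟩)
  have htt₀ : t₀ < t := by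
    refine lt_of_le_of_ne ht.1 fun h => ?_
    rw [← h] at hM
    rcases ht₀.1.eq_or_lt with h0 | h0
    · rw [← h0, hinit x hx] at hM
      exact (hψpos t₁ ht₁0).not_gt hM
    · exact (((hle t₀ ⟨h0, le_rfl⟩ x hx).trans (hψm ht₁.1.le)).trans_lt hM).false
  have ht0 : 0 < t := ht₀.1.trans_lt htt₀
  have hvpos : 0 < v x t := (hψpos t₁ ht₁0).trans hM
  have hxΩ : x ∈ Ω := by
    by_contra hxn
    have : x ∈ frontier Ω := by rw [hΩ.frontier_eq]; exact ⟨hx, hxn⟩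
    exact hvpos.ne' (hbdry x this t ⟨ht0, ht.2.trans_lt hb3⟩)
  have htS : t ∈ Ioo 0 T \ range s :=
    ⟨⟨ht0, ht.2.trans_lt hb3⟩, hSu ⟨htt₀, ht.2.trans_lt hb2⟩⟩
  set ε := v x t - ψ t with hε
  have hε0 : 0 < ε := by linarith [hψm ht.2]
  -- The index `none` stands for the added step of height `ε` at `t₀`.
  have hsum : ∀ r, ∑ o : Option (Fin (K + 1)), o.elim ε p * heaviside (r - o.elim t₀ s) =
      ε * heaviside (r - t₀) + ψ r := fun r => by simp [Fintype.sum_option, hψ]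
  have key := sum_singleBarrier_le_subdiffOp_of_max (b := b) hv
    (finite_range s).isClosed hΩ hΩb hα hxΩ htS
    (hA x hxΩ) (hc x hxΩ) (fun y hy => hmax' y (subset_closure hy) t ht)
    (fun o : Option (Fin (K + 1)) => o.elim ε p) (fun o => o.elim t₀ s)
    (fun o => by cases o with
      | none => exact ht₀.1
      | some k => exact hs k) (hinit x hx) (fun r hr => ?_) ?_ hvpos.le
  · simp only [Fintype.sum_option, Option.elim] at key
    have h1 := hop x hxΩ t htS
    rw [residualBarrier] at h1
    have h2 := hR (t - t₀) ⟨by linarith, by linarith [ht.2]⟩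
    rw [heaviside_of_pos (by linarith : 0 < t - t₀)] at key
    have := mul_pos hε0 h2
    linarith
  · rw [hsum]
    rcases le_or_gt r t₀ with h | h
    · rw [heaviside_of_nonpos (by linarith), mul_zero, zero_add]
      exact hle r ⟨hr.1, h⟩ x hx
    · rw [heaviside_of_pos (by linarith)]
      have h1 := hmax' x hx r ⟨h.le, hr.2.le.trans ht.2⟩
      have h2 := hψc t ⟨htt₀, ht.2.trans_lt hb2⟩ r ⟨h, hr.2.trans (ht.2.trans_lt hb2)⟩
      linarith
  · rw [hsum, heaviside_of_pos (by linarith)]; ring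

/-- The one-sided comparison principle, by continuous induction on the time up to which the bound
holds. -/
theorem le_sum_heaviside_of_subdiffOp_le (hΩ : IsOpen Ω) (hΩb : Bornology.IsBounded Ω)
    (hα : α ∈ Ioo 0 1) (hA : ∀ x ∈ Ω, (A x).PosSemidef) (hc : ∀ x ∈ Ω, lam ≤ c x)
    (hs : ∀ k, 0 ≤ s k) (hs0 : s 0 = 0) (hp : ∀ k, 0 < p k)
    (hv : IsRegular Ω T (range s) v) (hinit : ∀ x ∈ Ω, v x 0 = 0)
    (hbdry : ∀ x ∈ frontier Ω, ∀ t ∈ Ioo 0 T, v x t = 0)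
    (hop : ∀ x ∈ Ω, ∀ t ∈ Ioo 0 T \ range s,
      subdiffOp α A b c v x t ≤ residualBarrier α lam p s t) :
    ∀ t ∈ Ioo 0 T, ∀ x ∈ Ω, v x t ≤ ∑ k, p k * heaviside (t - s k) := by
  intro t₁ ht₁
  have hT : 0 < T := ht₁.1.trans ht₁.2
  have hinit' : ∀ x ∈ closure Ω, v x 0 = 0 := fun x hx => by
    have h := hv.continuousOn_space (t := 0) ⟨le_rfl, hT⟩
    exact (EqOn.of_subset_closure (g := fun _ => (0 : ℝ)) hinit h continuousOn_const
      subset_closure subset_rfl) hx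
  set G : Set ℝ := {t | ∀ r ∈ Ioc 0 t, ∀ x ∈ closure Ω, v x r ≤ ∑ k, p k * heaviside (r - s k)}
    with hG
  have hm : Monotone fun t => ∑ k, p k * heaviside (t - s k) :=
    monotone_sum_heaviside fun k => (hp k).le
  have hclosed : IsClosed (G ∩ Icc 0 t₁) := by
    refine isClosed_of_closure_subset fun t ht => ?_
    have htI : t ∈ Icc 0 t₁ := isClosed_Icc.closure_subset_iff.2 inter_subset_right ht
    have hlt : ∀ r ∈ Ioo 0 t, ∀ x ∈ closure Ω, v x r ≤ ∑ k, p k * heaviside (r - s k) := by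
      intro r hr
      obtain ⟨q, hq, hqG⟩ := mem_closure_iff_nhds.1 ht _ (Ioi_mem_nhds hr.2)
      exact hqG.1 r ⟨hr.1, (mem_Ioi.1 hq).le⟩
    refine ⟨fun r hr x hx => ?_, htI⟩
    rcases hr.2.eq_or_lt with rfl | h
    -- The limit time needs only that the sum of steps is monotone and `v` is left continuous.
    · have hcont : ContinuousWithinAt (v x) (Iio r) r := by
        have h1 := hv.continuousOn_time hx r ⟨hr.1.le, htI.2.trans_lt ht₁.2⟩
        refine h1.mono_of_mem_nhdsWithin ?_
        filter_upwards [Ioo_mem_nhdsLT hr.1] with q hq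
        exact ⟨hq.1.le, hq.2.trans (htI.2.trans_lt ht₁.2)⟩
      refine le_of_tendsto hcont.tendsto ?_
      filter_upwards [Ioo_mem_nhdsLT hr.1] with q hq
      exact (hlt q hq x hx).trans (hm hq.2.le)
    · exact hlt r ⟨hr.1, h⟩ x hx
  have hsub := hclosed.Icc_subset_of_forall_exists_gt (a := 0) (b := t₁)
    (fun r hr => absurd hr.1 hr.2.not_gt) ?_
  · intro x hx
    exact hsub ⟨ht₁.1.le, le_rfl⟩ t₁ ⟨ht₁.1, le_rfl⟩ x (subset_closure hx)
  · rintro t ⟨htG, ht⟩ y hy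
    obtain ⟨δ, hδ, h⟩ := exists_le_sum_heaviside_right hΩ hΩb hα hA hc hs hs0 hp hv hinit' hbdry hop
      ⟨ht.1, ht.2.trans ht₁.2⟩ htG
    refine ⟨min y (t + δ / 2), fun r hr x hx => ?_, lt_min hy (by linarith), min_le_left _ _⟩
    rcases le_or_gt r t with hrt | hrt
    · exact htG r ⟨hr.1, hrt⟩ x hx
    · exact h r ⟨hrt, by linarith [hr.2.trans (min_le_right _ _)]⟩ x hx

end Comparison

end Subdiffusion

open Subdiffusion in
theorem mainTheorem1 {d K : ℕ} (α T : ℝ) (hα : α ∈ Set.Ioo (0 : ℝ) 1)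
    -- the spatial domain
    (Ω : Set (EuclideanSpace ℝ (Fin d))) (hΩo : IsOpen Ω) (hΩb : Bornology.IsBounded Ω)
    (hΩn : Ω.Nonempty)
    -- the elliptic operator
    (A : EuclideanSpace ℝ (Fin d) → Matrix (Fin d) (Fin d) ℝ)
    (b : EuclideanSpace ℝ (Fin d) → Fin d → ℝ) (c : EuclideanSpace ℝ (Fin d) → ℝ)
    (hA : ContinuousOn A Ω) (hb : ContinuousOn b Ω) (hc : ContinuousOn c Ω)
    (hell : ∀ x ∈ Ω, (A x).PosDef)
    (hbdd : BddBelow (ellipticOp A b c (fun _ => 1) '' Ω))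
    -- the jump times and the right-hand side
    (s : Fin (K + 1) → ℝ) (hs : StrictMono s) (hs0 : s 0 = 0) (hsT : s (Fin.last K) < T)
    (f : Fin (K + 1) → EuclideanSpace ℝ (Fin d) → ℝ → ℝ)
    (hf : ∀ k, ContinuousOn (fun p : EuclideanSpace ℝ (Fin d) × ℝ => f k p.1 p.2)
      (Ω ×ˢ Set.Ico (s k) T))
    -- the exact solution
    (u₀ : EuclideanSpace ℝ (Fin d) → ℝ)
    (u : EuclideanSpace ℝ (Fin d) → ℝ → ℝ) (hu : IsRegular Ω T (Set.range s) u)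
    (hu_eq : ∀ x ∈ Ω, ∀ t ∈ Set.Ioo 0 T \ Set.range s,
      subdiffOp α A b c u x t = jumpRhs s f x t)
    (hu_init : ∀ x ∈ Ω, u x 0 = u₀ x)
    (hu_bdry : ∀ x ∈ frontier Ω, ∀ t ∈ Set.Ioo 0 T, u x t = 0)
    -- the numerical approximation
    (uh : EuclideanSpace ℝ (Fin d) → ℝ → ℝ) (huh : IsRegular Ω T (Set.range s) uh)
    (huh_init : ∀ x ∈ Ω, uh x 0 = u₀ x)
    (huh_bdry : ∀ x ∈ frontier Ω, ∀ t ∈ Set.Ioo 0 T, uh x t = 0)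
    -- the weights and the tolerance
    (w : Fin (K + 1) → ℝ) (hw : ∀ k, 0 < w k) (W : ℝ) (hW : ∑ k, w k = W)
    (TOL : ℝ) (hTOL : 0 < TOL)
    -- the bound of the residual `f - (∂_t^α + L) u_h`
    (hres : ∀ t ∈ Set.Ioo 0 T \ Set.range s,
      linftyNorm Ω (fun x => jumpRhs s f x t - subdiffOp α A b c uh x t) ≤
        ((TOL * residualBarrier α (lowerConst A b c Ω) w s t : ℝ) : EReal)) :
    ∀ t ∈ Set.Ioo 0 T,
      linftyNorm Ω (fun x => u x t - uh x t) ≤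
          ((TOL * ∑ k, w k * heaviside (t - s k) : ℝ) : EReal) ∧
        TOL * ∑ k, w k * heaviside (t - s k) ≤ TOL * W := by
  have hS : IsClosed (Set.range s) := (Set.finite_range s).isClosed
  have hs' : ∀ k, 0 ≤ s k := fun k => hs0 ▸ hs.monotone (Fin.zero_le k)
  have hlam : ∀ x ∈ Ω, lowerConst A b c Ω ≤ c x := fun x hx => by
    rw [← ellipticOp_const_one A b c x]
    exact csInf_le hbdd ⟨x, hx, rfl⟩
  have hR : ∀ x ∈ Ω, ∀ t ∈ Set.Ioo 0 T \ Set.range s,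
      |subdiffOp α A b c u x t - subdiffOp α A b c uh x t| ≤
        residualBarrier α (lowerConst A b c Ω) (fun k => TOL * w k) s t := by
    intro x hx t ht
    -- The exact solution absorbs `f`, so the residual inherits its continuity from `u` and `uh`.
    have hcongr : Set.EqOn (fun y => jumpRhs s f y t - subdiffOp α A b c uh y t)
        (fun y => subdiffOp α A b c u y t - subdiffOp α A b c uh y t) Ω := fun y hy => by
      simp only [hu_eq y hy t ht]
    have hcont := ((hu.continuousOn_subdiffOp hS hΩo hΩb hα hA hb hc ht).sub
      (huh.continuousOn_subdiffOp hS hΩo hΩb hα hA hb hc ht)).congr hcongr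
    have h := abs_le_of_linftyNorm_le hΩo hcont (hres t ht) x hx
    rw [hu_eq x hx t ht]
    refine h.trans_eq ?_
    simp only [residualBarrier, Finset.mul_sum, mul_assoc]
  have hp : ∀ k, 0 < TOL * w k := fun k => mul_pos hTOL (hw k)
  have hA' : ∀ x ∈ Ω, (A x).PosSemidef := fun x hx => (hell x hx).posSemidef
  have h1 := le_sum_heaviside_of_subdiffOp_le hΩo hΩb hα hA' hlam hs' hs0 hp (hu.sub huh)
    (fun x hx => by rw [hu_init x hx, huh_init x hx, sub_self])
    (fun x hx t ht => by rw [hu_bdry x hx t ht, huh_bdry x hx t ht, sub_self])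
    (fun x hx t ht => by
      rw [hu.subdiffOp_sub huh hS hΩo hα.2 hx ht]
      exact (le_abs_self _).trans (hR x hx t ht))
  have h2 := le_sum_heaviside_of_subdiffOp_le hΩo hΩb hα hA' hlam hs' hs0 hp (huh.sub hu)
    (fun x hx => by rw [hu_init x hx, huh_init x hx, sub_self])
    (fun x hx t ht => by rw [hu_bdry x hx t ht, huh_bdry x hx t ht, sub_self])
    (fun x hx t ht => by
      rw [huh.subdiffOp_sub hu hS hΩo hα.2 hx ht, ← neg_sub]
      exact (neg_le_abs _).trans (hR x hx t ht))
  intro t ht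
  have hsum : ∑ k, TOL * w k * heaviside (t - s k) = TOL * ∑ k, w k * heaviside (t - s k) := by
    simp only [Finset.mul_sum, mul_assoc]
  refine ⟨linftyNorm_le_of_abs_le hΩo.measurableSet ?_ fun x hx => ?_, ?_⟩
  · exact mul_nonneg hTOL.le (Finset.sum_nonneg fun k _ =>
      mul_nonneg (hw k).le (heaviside_nonneg _))
  · rw [← hsum, abs_le]
    exact ⟨by linarith [h2 t ht x hx], h1 t ht x hx⟩
  · rw [← hW]
    refine mul_le_mul_of_nonneg_left (Finset.sum_le_sum fun k _ => ?_) hTOL.le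
    exact mul_le_of_le_one_right (hw k).le (heaviside_le_one _)
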